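/- Let $K$ be a field of characteristic zero, let $V$ be a finite-dimensional vector space over $K$, and let $\mathfrak g=(V,[\,,])$ and $\mathfrak n=(V,\{\,,\})$ be two Lie algebra structures on $V$. A post-Lie algebra structure on $(\mathfrak g,\mathfrak n)$ is a $K$-bilinear product $x\cdot y$ on $V$ such that, for all $x,y,z\in V$, \[ x\cdot y-y\cdot x=[x,y]-\{x,y\},\qquad [x,y]\cdot z=x\cdot(y\cdot z)-y\cdot(x\cdot z),\qquad x\cdot\{y,z\}=\{x\cdot y,z\}+\{y,x\cdot z\}. \] It makes $\mathfrak n$ a $\mathfrak g$-module through $L(x)y=x\cdot y$. Put $H^0(\mathfrak g,\mathfrak n)=\{y\in\mathfrak n\mid x\cdot y=0\text{ for all }x\in\mathfrak g\}$. Let $x\cdot y$ be a post-Lie algebra structure on $(\mathfrak g,\mathfrak n)$, where $\mathfrak g$ is nilpotent and $H^0(\mathfrak g,\mathfrak n)=0$. Let $F$ be an algebraically closed extension field of $K$ (one may take $F=K$ if $K$ is algebraically closed), and let $X$ be the set of weights of the module $F\otimes_K\mathfrak n$ over the Lie algebra $F\otimes_K\mathfrak g$, that is, of all $\alpha\colon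 F\otimes_K\mathfrak g\to F$ for which there is a non-zero $v\in F\otimes_K\mathfrak n$ such that every $x\in F\otimes_K\mathfrak g$ satisfies $(L(x)-\alpha(x)\,\mathrm{id})^k v=0$ for some $k\ge 0$, where $L(x)$ denotes the action of $x$. Then $X$ is finite, and $\mathfrak n$ is nilpotent of class at most $|X|^{2^{|X|}}$, i.e. the term $\mathfrak n^{c+1}$ with $c=|X|^{2^{|X|}}$ of the lower central series $\mathfrak n^1=\mathfrak n$, $\mathfrak n^{i+1}=\{\mathfrak n,\mathfrak n^i\}$ vanishes. -/

import Mathlib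

open scoped TensorProduct

/-- A Lie bracket on a vector space `V` over `K`: a bilinear, alternating operation satisfying
the Jacobi identity. Several brackets may live on the same space `V`. -/
structure LieBracket (K V : Type*) [Field K] [AddCommGroup V] [Module K V] where
  /-- The bracket. -/
  br : V →ₗ[K] V →ₗ[K] V
  br_self : ∀ x, br x x = 0
  jacobi : ∀ x y z, br x (br y z) = br (br x y) z + br y (br x z)

namespace LieBracket

variable {K V : Type*} [Field K] [AddCommGroup V] [Module K V]

/-- The Lie algebra `(V, b)`: the space `V` equipped with the bracket `b`. -/
def Alg (_b : LieBracket K V) : Type _ := V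

variable (b : LieBracket K V)

instance : AddCommGroup b.Alg := inferInstanceAs (AddCommGroup V)

instance : Module K b.Alg := inferInstanceAs (Module K V)

instance : LieRing b.Alg where
  bracket x y := b.br x y
  add_lie x y z := LinearMap.map_add₂ b.br x y z
  lie_add x y z := map_add (b.br x) y z
  lie_self x := b.br_self x
  leibniz_lie x y z := b.jacobi x y z

instance : LieAlgebra K b.Alg where
  lie_smul t x y := map_smul (b.br x) t y

end LieBracket

/-- A post-Lie algebra structure on the pair of Lie algebras `(V, g)`, `(V, n)`: a bilinear
product `mul x y = x · y` on `V`, with `[x, y] = g.br x y` and `{x, y} = n.br x y`. -/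
structure PostLieStructure {K V : Type*} [Field K] [AddCommGroup V] [Module K V]
    (g n : LieBracket K V) where
  /-- The product. -/
  mul : V →ₗ[K] V →ₗ[K] V
  /-- `x · y - y · x = [x, y] - {x, y}` -/
  mul_sub_mul : ∀ x y, mul x y - mul y x = g.br x y - n.br x y
  /-- `[x, y] · z = x · (y · z) - y · (x · z)` -/
  br_mul : ∀ x y z, mul (g.br x y) z = mul x (mul y z) - mul y (mul x z)
  /-- `x · {y, z} = {x · y, z} + {y, x · z}` -/
  mul_br : ∀ x y z, mul x (n.br y z) = n.br (mul x y) z + n.br y (mul x z)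

namespace PostLieStructure

variable {K V : Type*} [Field K] [AddCommGroup V] [Module K V] {g n : LieBracket K V}

/-- The underlying space `V` of `n`, regarded as a module over the Lie algebra `(V, g)`
through left multiplication `x · y`. -/
def Mod (_A : PostLieStructure g n) : Type _ := V

variable (A : PostLieStructure g n)

instance : AddCommGroup A.Mod := inferInstanceAs (AddCommGroup V)

instance : Module K A.Mod := inferInstanceAs (Module K V)

instance : LieRingModule g.Alg A.Mod where
  bracket x y := A.mul x y
  add_lie x y z := LinearMap.map_add₂ A.mul x y z
  lie_add x y z := map_add (A.mul x) y z
  leibniz_lie x y z := eq_add_of_sub_eq (A.br_mul x y z).symm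

instance : LieModule K g.Alg A.Mod where
  smul_lie t x y := LinearMap.map_smul₂ A.mul t x y
  lie_smul t x y := map_smul (A.mul x) t y

/-- The zeroth cohomology `H⁰(g, n) = {y | x · y = 0 for all x}`. -/
def H0 : Submodule K A.Mod := (LieModule.maxTrivSubmodule K g.Alg A.Mod).toSubmodule

/-- The weights of the `g`-module `n` with values in the extension field `F` of `K`: those
`α : F ⊗ g → F` for which the (generalized) weight space of `α` in `F ⊗ n` is non-zero.
When `F = K` this is, up to `K ⊗ V ≅ V`, the set of weights of the `g`-module `n` itself. -/
abbrev Weights [LieRing.IsNilpotent g.Alg] (F : Type*) [Field F] [Algebra K F] : Type _ :=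
  LieModule.Weight F (F ⊗[K] g.Alg) (F ⊗[K] A.Mod)

end PostLieStructure

/-! Over `F` the Lie algebra is the sum of its generalized weight spaces, and these multiply
additively because the action is by derivations. The zero weight space vanishes by Engel's theorem,
since there are no invariants. A `ℚ`-linear functional that is nonzero on each weight turns this
into a grading by the ordered group `ℚ` with finite support `X` and trivial zero component. Such an
algebra is solvable (`derivedSeries_two_pow_eq_bot`): passing to derived algebras removes the
positive weights from the top down by commutator rewriting, after which the remaining negative
weights are used up one by one. It is then nilpotent (`lowerCentralSeries_le_derivedSeries`): a long
commutator starting in a derived ideal can be sorted so that its weight first climbs and then falls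
through `X`. Each run has fewer than `|X|` steps, so some entry must lie deep in the lower central
series, which pushes the commutator into the next derived ideal. Nilpotency descends from `F` to `K`
by faithful flatness. -/

namespace LieGrading

/-! ### Graded families, their derived families and generated subfamilies. -/

variable {R L ι : Type*} [CommRing R] [LieRing L] [LieAlgebra R L] [AddCommGroup ι]

/-- A family of submodules `A i` with `⁅A i, A j⁆ ⊆ A (i + j)` and `A 0 = 0`. -/
structure IsGraded (A : ι → Submodule R L) : Prop where
  lie_mem : ∀ {i j x y}, x ∈ A i → y ∈ A j → ⁅x, y⁆ ∈ A (i + j)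
  zero_eq : A 0 = ⊥

/-- The homogeneous components of the derived algebra of a graded family. -/
def derived (A : ι → Submodule R L) (a : ι) : Submodule R L :=
  Submodule.span R {m | ∃ i j x y, i + j = a ∧ x ∈ A i ∧ y ∈ A j ∧ ⁅x, y⁆ = m}

/-- Homogeneous commutators in the components `A l`, `l ∈ S`. -/
inductive IsComm (A : ι → Submodule R L) (S : Set ι) : ι → L → Prop
  | of {i x} : i ∈ S → x ∈ A i → IsComm A S i x
  | lie {i j k x y} : i + j = k → IsComm A S i x → IsComm A S j y → IsComm A S k ⁅x, y⁆

/-- The homogeneous components of the subalgebra generated by the `A l`, `l ∈ S`. -/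
def gen (A : ι → Submodule R L) (S : Set ι) (i : ι) : Submodule R L :=
  Submodule.span R {x | IsComm A S i x}

theorem lie_mem_of_span {s t : Set L} {N : Submodule R L}
    (h : ∀ x ∈ s, ∀ y ∈ t, ⁅x, y⁆ ∈ N) {x y : L}
    (hx : x ∈ Submodule.span R s) (hy : y ∈ Submodule.span R t) : ⁅x, y⁆ ∈ N := by
  induction hx, hy using Submodule.span_induction₂ with
  | mem_mem x y hx hy => exact h x hx y hy
  | zero_left => simp
  | zero_right => simp
  | add_left _ _ _ _ _ _ h1 h2 => rw [add_lie]; exact N.add_mem h1 h2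
  | add_right _ _ _ _ _ _ h1 h2 => rw [lie_add]; exact N.add_mem h1 h2
  | smul_left r _ _ _ _ h1 => rw [smul_lie]; exact N.smul_mem r h1
  | smul_right r _ _ _ _ h1 => rw [lie_smul]; exact N.smul_mem r h1

theorem lie_mem_of_span_left {s : Set L} {N : Submodule R L} {y : L}
    (h : ∀ x ∈ s, ⁅x, y⁆ ∈ N) {x : L} (hx : x ∈ Submodule.span R s) : ⁅x, y⁆ ∈ N :=
  lie_mem_of_span (t := {y}) (by simpa using h) hx (Submodule.mem_span_singleton_self y)

theorem lie_mem_of_span_right {t : Set L} {N : Submodule R L} {x : L}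
    (h : ∀ y ∈ t, ⁅x, y⁆ ∈ N) {y : L} (hy : y ∈ Submodule.span R t) : ⁅x, y⁆ ∈ N :=
  lie_mem_of_span (s := {x}) (by simpa using h) (Submodule.mem_span_singleton_self x) hy

section Basic

variable {A B : ι → Submodule R L}

theorem lie_mem_derived {i j k : ι} {x y : L} (hk : i + j = k) (hx : x ∈ A i) (hy : y ∈ A j) :
    ⁅x, y⁆ ∈ derived A k :=
  Submodule.subset_span ⟨i, j, x, y, hk, hx, hy, rfl⟩

theorem derived_le_iff {a : ι} {N : Submodule R L} :
    derived A a ≤ N ↔ ∀ i j x y, i + j = a → x ∈ A i → y ∈ A j → ⁅x, y⁆ ∈ N := by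
  rw [derived, Submodule.span_le]
  constructor
  · intro h i j x y hij hx hy
    exact h ⟨i, j, x, y, hij, hx, hy, rfl⟩
  · rintro h _ ⟨i, j, x, y, hij, hx, hy, rfl⟩
    exact h i j x y hij hx hy

theorem IsGraded.lie_mem' (hA : IsGraded A) {i j k : ι} {x y : L} (hk : i + j = k) (hx : x ∈ A i)
    (hy : y ∈ A j) : ⁅x, y⁆ ∈ A k :=
  hk ▸ hA.lie_mem hx hy

theorem IsGraded.eq_zero (hA : IsGraded A) {i : ι} {x : L} (hi : i = 0) (hx : x ∈ A i) :
    x = 0 := by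
  subst hi
  rwa [hA.zero_eq, Submodule.mem_bot] at hx

theorem IsGraded.derived_le (hA : IsGraded A) (i : ι) : derived A i ≤ A i :=
  derived_le_iff.2 fun _ _ _ _ h hx hy ↦ hA.lie_mem' h hx hy

theorem IsGraded.derived (hA : IsGraded A) : IsGraded (derived A) where
  lie_mem hx hy := lie_mem_derived rfl (hA.derived_le _ hx) (hA.derived_le _ hy)
  zero_eq := le_bot_iff.1 (hA.zero_eq ▸ hA.derived_le 0)

theorem IsGraded.iterate (hA : IsGraded A) (r : ℕ) : IsGraded (LieGrading.derived^[r] A) := by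
  induction r with
  | zero => exact hA
  | succ r ih => rw [Function.iterate_succ_apply']; exact ih.derived

theorem IsGraded.iterate_le (hA : IsGraded A) (r : ℕ) (i : ι) :
    LieGrading.derived^[r] A i ≤ A i := by
  induction r with
  | zero => exact le_rfl
  | succ r ih =>
    rw [Function.iterate_succ_apply']
    exact ((hA.iterate r).derived_le i).trans ih

theorem lie_mem_gen {S : Set ι} {i j k : ι} {x y : L} (hk : i + j = k) (hx : x ∈ gen A S i)
    (hy : y ∈ gen A S j) : ⁅x, y⁆ ∈ gen A S k :=
  lie_mem_of_span (fun _ h1 _ h2 ↦ Submodule.subset_span (IsComm.lie hk h1 h2)) hx hy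

theorem le_gen {S : Set ι} {i : ι} (hi : i ∈ S) : A i ≤ gen A S i :=
  fun _ hx ↦ Submodule.subset_span (IsComm.of hi hx)

theorem mem_gen {S : Set ι} {i : ι} {x : L} (hi : i ∈ S) (hx : x ∈ A i) : x ∈ gen A S i :=
  le_gen hi hx

theorem gen_le_gen {S T : Set ι} (h : ∀ i ∈ S, A i ≤ gen B T i) (i : ι) :
    gen A S i ≤ gen B T i := by
  refine Submodule.span_le.2 fun x hx ↦ ?_
  induction hx with
  | of hi hx => exact h _ hi hx
  | lie hk _ _ h1 h2 => exact lie_mem_gen hk h1 h2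

theorem IsGraded.gen_le (hA : IsGraded A) (S : Set ι) (i : ι) : gen A S i ≤ A i := by
  refine Submodule.span_le.2 fun x hx ↦ ?_
  induction hx with
  | of _ hx => exact hx
  | lie hk _ _ h1 h2 => exact hA.lie_mem' hk h1 h2

theorem derivedSeries_le_iSup (hA : ⨆ i, A i = ⊤) (r : ℕ) :
    (LieAlgebra.derivedSeries R L r).toSubmodule ≤ ⨆ i, derived^[r] A i := by
  induction r with
  | zero => simp [hA]
  | succ r ih =>
    rw [LieAlgebra.derivedSeries_def, LieAlgebra.derivedSeriesOfIdeal_succ,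
      LieSubmodule.lieIdeal_oper_eq_linear_span',
      Submodule.span_le]
    rintro _ ⟨x, hx, y, hy, rfl⟩
    have hx := ih hx
    have hy := ih hy
    rw [Submodule.iSup_eq_span] at hx hy
    refine lie_mem_of_span (fun x hx y hy ↦ ?_) hx hy
    obtain ⟨i, hx⟩ := Set.mem_iUnion.1 hx
    obtain ⟨j, hy⟩ := Set.mem_iUnion.1 hy
    rw [Function.iterate_succ_apply']
    exact Submodule.mem_iSup_of_mem (i + j) (lie_mem_derived rfl hx hy)

theorem iterate_le_derivedSeries (r : ℕ) (i : ι) :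
    derived^[r] A i ≤ (LieAlgebra.derivedSeries R L r).toSubmodule := by
  induction r generalizing i with
  | zero => simp
  | succ r ih =>
    rw [Function.iterate_succ_apply', derived_le_iff]
    intro i j x y _ hx hy
    rw [LieAlgebra.derivedSeries_def, LieAlgebra.derivedSeriesOfIdeal_succ]
    exact LieSubmodule.lie_mem_lie (ih i hx) (ih j hy)

end Basic

/-! ### Ordered gradings: bounding the derived length. -/

section Order

variable [LinearOrder ι] {A M : ι → Submodule R L}

/-- Left-normed commutators `[x, z₁, …, z_s]` with `x` of negative weight and every `z_i` of
weight in `(0, a]`. -/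
inductive IsNegPos (A : ι → Submodule R L) (a : ι) : ι → L → Prop
  | neg {i x} : i < 0 → x ∈ A i → IsNegPos A a i x
  | lie {i j k x y} : i + j = k → 0 < j → j ≤ a → IsNegPos A a i x → y ∈ A j →
      IsNegPos A a k ⁅x, y⁆

/-- The span of the commutators of weight `i` described by `IsNegPos`. -/
def negPos (A : ι → Submodule R L) (a i : ι) : Submodule R L :=
  Submodule.span R {x | IsNegPos A a i x}

theorem lie_mem_negPos_of_pos {a i j k : ι} {x y : L} (hk : i + j = k) (hj : 0 < j) (hja : j ≤ a)
    (hx : x ∈ negPos A a i) (hy : y ∈ A j) : ⁅x, y⁆ ∈ negPos A a k :=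
  lie_mem_of_span_left
    (fun _ h ↦ Submodule.subset_span (IsNegPos.lie hk hj hja h hy)) hx

theorem IsNegPos.mem (hA : IsGraded A) {a k : ι} {r : L} (h : IsNegPos A a k r) : r ∈ A k := by
  induction h with
  | neg _ hx => exact hx
  | lie hk _ _ _ hy ih => exact hA.lie_mem' hk ih hy

variable [IsOrderedAddMonoid ι]

/-- A negative entry is moved leftwards by the Jacobi identity until it is absorbed into the
negative head. -/
theorem lie_mem_negPos_of_neg (hA : IsGraded A) {a i j k : ι} {x y : L} (hk : i + j = k)
    (hj : j < 0) (hx : x ∈ negPos A a i) (hy : y ∈ A j) : ⁅x, y⁆ ∈ negPos A a k := by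
  refine lie_mem_of_span_left (fun w hw ↦ ?_) hx
  clear hx x
  induction hw generalizing j k y with
  | neg hi hx =>
    exact Submodule.subset_span (IsNegPos.neg (hk ▸ add_neg hi hj) (hA.lie_mem' hk hx hy))
  | @lie i l m r z hm hl hla hr hz ih =>
    subst hm hk
    have h1 : ⁅⁅r, y⁆, z⁆ ∈ negPos A a (i + l + j) :=
      lie_mem_negPos_of_pos (by abel) hl hla (ih rfl hj hy) hz
    have h2 : ⁅r, ⁅z, y⁆⁆ ∈ negPos A a (i + l + j) := by
      -- The merged entry `⁅z, y⁆` has weight below `l ≤ a`, so it is again negative, zero, or an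
      -- admissible positive entry.
      have hzy := hA.lie_mem hz hy
      rcases lt_trichotomy (l + j) 0 with h | h | h
      · exact ih (by abel) h hzy
      · rw [hA.eq_zero h hzy, lie_zero]; exact Submodule.zero_mem _
      · refine lie_mem_negPos_of_pos (by abel) h ?_ (Submodule.subset_span hr) hzy
        exact (add_lt_of_neg_right l hj).le.trans hla
    have : ⁅⁅r, z⁆, y⁆ = ⁅⁅r, y⁆, z⁆ + ⁅r, ⁅z, y⁆⁆ := by
      rw [leibniz_lie r z y, ← lie_skew ⁅r, y⁆ z]; abel
    rw [this]
    exact Submodule.add_mem _ h1 h2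

theorem lie_mem_negPos_of_mem_gen (hA : IsGraded A) {a i j k : ι} {x y : L} (hk : i + j = k)
    (hx : x ∈ negPos A a i) (hy : y ∈ gen A (Set.Iic a) j) : ⁅x, y⁆ ∈ negPos A a k := by
  refine lie_mem_of_span_right (fun w hw ↦ ?_) hy
  clear hy y
  induction hw generalizing x i k with
  | @of l y hl hy =>
    rcases lt_trichotomy l 0 with h | h | h
    · exact lie_mem_negPos_of_neg hA hk h hx hy
    · rw [hA.eq_zero h hy, lie_zero]; exact Submodule.zero_mem _
    · exact lie_mem_negPos_of_pos hk h hl hx hy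
  | @lie l m n y z hn _ _ h1 h2 =>
    subst hn hk
    have : ⁅x, ⁅y, z⁆⁆ = ⁅⁅x, y⁆, z⁆ - ⁅⁅x, z⁆, y⁆ := by
      rw [leibniz_lie x y z, ← lie_skew ⁅x, z⁆ y]; abel
    rw [this]
    exact Submodule.sub_mem _ (h2 (by abel) (h1 rfl hx)) (h1 (by abel) (h2 rfl hx))

/-- The total weight `a` is positive, so there is a last entry of positive weight `j ≤ a`. If `j =
a` the prefix has weight zero and vanishes; otherwise both prefix and entry have weight below `a`.
-/
theorem IsNegPos.mem_gen_Iio (hA : IsGraded A) {a : ι} (ha : 0 < a) {r : L}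
    (h : IsNegPos A a a r) : r ∈ gen A (Set.Iio a) a := by
  cases h with
  | neg h _ => exact absurd ha h.not_gt
  | @lie i j k x y hk hj hja hx hy =>
    rcases hja.eq_or_lt with rfl | hja
    · have hi : i = 0 := add_eq_right.1 hk
      have hx0 : x = 0 := hA.eq_zero hi (hx.mem hA)
      rw [hx0, zero_lie]
      exact Submodule.zero_mem _
    · have hi : i < a := (lt_add_of_pos_right i hj).trans_eq hk
      exact lie_mem_gen hk (mem_gen (Set.mem_Iio.2 hi) (hx.mem hA))
        (mem_gen (Set.mem_Iio.2 hja) hy)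

/-- A component of positive weight `a` of the derived algebra of a graded family contained in
`⟨A l : l ≤ a⟩` lies in `⟨A l : l < a⟩`. -/
theorem derived_le_gen_Iio (hA : IsGraded A) {a : ι} (ha : 0 < a)
    (hM : ∀ i, M i ≤ gen A (Set.Iic a) i) : derived M a ≤ gen A (Set.Iio a) a := by
  -- If one factor has weight above `a`, the other is negative and serves as the head of commutators
  -- in `negPos`.
  have key {i j : ι} {x y : L} (hij : i + j = a) (hi : a ≤ i) (hx : x ∈ M i) (hy : y ∈ M j) :
      ⁅y, x⁆ ∈ gen A (Set.Iio a) a := by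
    have hyA := hA.gen_le _ _ (hM _ hy)
    rcases hi.eq_or_lt with rfl | hi
    · have hy0 : y = 0 := hA.eq_zero (add_eq_left.1 hij) hyA
      rw [hy0, zero_lie]
      exact Submodule.zero_mem _
    have hj : j < 0 := by
      by_contra! h
      exact absurd hij (lt_add_of_lt_of_nonneg hi h).ne'
    have : ⁅y, x⁆ ∈ negPos A a a :=
      lie_mem_negPos_of_mem_gen hA ((add_comm _ _).trans hij)
        (Submodule.subset_span (IsNegPos.neg hj hyA)) (hM _ hx)
    exact (Submodule.span_le.2 fun r hr ↦ IsNegPos.mem_gen_Iio hA ha hr) this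
  refine derived_le_iff.2 fun i j x y hij hx hy ↦ ?_
  rcases le_or_gt a i with hi | hi
  · rw [← lie_skew]
    exact Submodule.neg_mem _ (key hij hi hx hy)
  rcases le_or_gt a j with hj | hj
  · exact key ((add_comm _ _).trans hij) hj hy hx
  exact lie_mem_gen hij (mem_gen (Set.mem_Iio.2 hi) (hA.gen_le _ _ (hM _ hx)))
    (mem_gen (Set.mem_Iio.2 hj) (hA.gen_le _ _ (hM _ hy)))

/-- Induction on the number `k` of support weights above `a`. Lowering the threshold from the next
weight `b` to `a` costs one derivation and two uses of the case `k`: `2 * (2 ^ k - 1) + 1 = 2 ^ (k +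
1) - 1`. -/
theorem iterate_derived_le_gen_Iic {X : Finset ι} {a : ι} (ha : 0 ≤ a) {k : ℕ}
    (hk : (X.filter (a < ·)).card = k) {A : ι → Submodule R L} (hA : IsGraded A)
    (hX : ∀ i ∉ X, A i = ⊥) (i : ι) :
    derived^[2 ^ k - 1] A i ≤ gen A (Set.Iic a) i := by
  induction k generalizing a A i with
  | zero =>
    rcases le_or_gt i a with hi | hi
    · exact le_gen (A := A) hi
    · have : i ∉ X := fun h ↦ by
        rw [Finset.card_eq_zero] at hk
        exact (Finset.filter_eq_empty_iff.1 hk) h hi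
      simp [hX i this]
  | succ k ih =>
    have hne : (X.filter (a < ·)).Nonempty := Finset.card_pos.1 (by omega)
    obtain ⟨b, hb, hmin⟩ := Finset.exists_min_image _ id hne
    obtain ⟨hbX, hab⟩ := Finset.mem_filter.1 hb
    have hmin' : ∀ l ∈ X, a < l → b ≤ l := fun l h1 h2 ↦ hmin l (Finset.mem_filter.2 ⟨h1, h2⟩)
    have hcard : (X.filter (b < ·)).card = k := by
      have : X.filter (b < ·) = (X.filter (a < ·)).erase b := by
        ext l
        simp only [Finset.mem_filter, Finset.mem_erase]
        constructor
        · rintro ⟨h1, h2⟩; exact ⟨h2.ne', h1, hab.trans h2⟩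
        · rintro ⟨h1, h2, h3⟩; exact ⟨h2, lt_of_le_of_ne (hmin' l h2 h3) h1.symm⟩
      rw [this, Finset.card_erase_of_mem hb, hk, Nat.add_sub_cancel]
    have hb0 : 0 < b := ha.trans_lt hab
    have ih' := fun {A : ι → Submodule R L} (hA : IsGraded A) hX i ↦
      ih hb0.le hcard (A := A) hA hX i
    set M := derived^[2 ^ k] A with hM
    have hMA : ∀ i, M i ≤ A i := hA.iterate_le _
    have hpow : 0 < 2 ^ k := by positivity
    have hMb : ∀ i ∈ Set.Iic b, M i ≤ gen A (Set.Iic a) i := by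
      intro i hi
      rcases le_or_gt i a with hia | hia
      · exact (hMA i).trans (le_gen hia)
      rcases (show i ≤ b from hi).eq_or_lt with rfl | hib
      -- The extra derivation removes the generators of weight `b`; no support weight lies strictly
      -- between `a` and `b`.
      · have h := derived_le_gen_Iio hA hb0 (ih' hA hX)
        rw [← Function.iterate_succ_apply' derived, Nat.succ_eq_add_one,
          Nat.sub_add_cancel hpow] at h
        refine h.trans (gen_le_gen (fun l hl ↦ ?_) _)
        rcases le_or_gt l a with hla | hla
        · exact le_gen hla
        · rw [hX l fun h ↦ (hmin' l h hla).not_gt hl]; exact bot_le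
      · refine (hMA i).trans ?_
        rw [hX i fun h ↦ (hmin' i h hia).not_gt hib]; exact bot_le
    have h := ih' (A := M) (hA.iterate _) (fun i hi ↦ le_bot_iff.1 (hX i hi ▸ hMA i)) i
    rw [hM, ← Function.iterate_add_apply, ← hM] at h
    rw [show 2 ^ (k + 1) - 1 = 2 ^ k - 1 + 2 ^ k by rw [pow_succ]; omega]
    exact h.trans (gen_le_gen hMb i)

/-- A nonzero bracket of weight `i` has both factors of weight strictly between `i` and `0`, so each
derivation uses up a support weight. -/
theorem iterate_derived_eq_bot_of_neg {X : Finset ι} {A : ι → Submodule R L} (hA : IsGraded A)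
    (hX : ∀ i ∉ X, A i = ⊥) (hpos : ∀ i, 0 < i → A i = ⊥) (r : ℕ) (i : ι)
    (hr : (X.filter fun l ↦ i < l ∧ l < 0).card < r) : derived^[r] A i = ⊥ := by
  induction r generalizing i with
  | zero => omega
  | succ r ih =>
    rw [Function.iterate_succ_apply', ← le_bot_iff, derived_le_iff]
    intro j l x y hjl hx hy
    by_contra hne
    have hx0 : x ≠ 0 := by rintro rfl; simp at hne
    have hy0 : y ≠ 0 := by rintro rfl; simp at hne
    have hneg {j x} (hx : x ∈ derived^[r] A j) (hx0 : x ≠ 0) : j < 0 := by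
      have hxA := hA.iterate_le r j hx
      rcases lt_trichotomy j 0 with h | h | h
      · exact h
      · exact absurd (hA.eq_zero h hxA) hx0
      · rw [hpos j h] at hxA; exact absurd hxA hx0
    have hj := hneg hx hx0
    have hl := hneg hy hy0
    have hij : i < j := by rw [← hjl]; exact add_lt_of_neg_right j hl
    have hjX : j ∈ X := by
      by_contra h
      have hxA := hA.iterate_le r j hx
      rw [hX j h] at hxA
      exact hx0 hxA
    have hlt : (X.filter fun l ↦ j < l ∧ l < 0).card < (X.filter fun l ↦ i < l ∧ l < 0).card := by
      refine Finset.card_lt_card (Finset.ssubset_iff_of_subset ?_ |>.2 ⟨j, ?_, ?_⟩)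
      · intro m
        simp only [Finset.mem_filter]
        exact fun ⟨h1, h2, h3⟩ ↦ ⟨h1, hij.trans h2, h3⟩
      · simp [hjX, hij, hj]
      · simp
    rw [ih j (by omega)] at hx
    exact hx0 hx

theorem iterate_derived_eq_bot {X : Finset ι} {A : ι → Submodule R L} (hA : IsGraded A)
    (hX : ∀ i ∉ X, A i = ⊥) (i : ι) :
    derived^[(X.filter (· < 0)).card + (2 ^ (X.filter (0 < ·)).card - 1)] A i = ⊥ := by
  rw [Function.iterate_add_apply]
  set B := derived^[2 ^ (X.filter (0 < ·)).card - 1] A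
  have hB : IsGraded B := hA.iterate _
  have hBA : ∀ i, B i ≤ A i := hA.iterate_le _
  have hBX : ∀ i ∉ X, B i = ⊥ := fun i hi ↦ le_bot_iff.1 (hX i hi ▸ hBA i)
  have hpos : ∀ i, 0 < i → B i = ⊥ := by
    intro i hi
    rw [← le_bot_iff]
    refine (iterate_derived_le_gen_Iic le_rfl rfl hA hX i).trans (Submodule.span_le.2 ?_)
    have hle {i x} (h : IsComm A (Set.Iic 0) i x) : i ≤ 0 := by
      induction h with
      | of h _ => exact h
      | lie hk _ _ h1 h2 => rw [← hk]; exact add_nonpos h1 h2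
    exact fun x hx ↦ absurd hi (hle hx).not_gt
  rcases lt_or_ge i 0 with hi | hi
  · by_cases hiX : i ∈ X
    · refine iterate_derived_eq_bot_of_neg hB hBX hpos _ i ?_
      refine Finset.card_lt_card (Finset.ssubset_iff_of_subset ?_ |>.2 ⟨i, ?_, ?_⟩)
      · intro m
        simp only [Finset.mem_filter]
        exact fun ⟨h1, h2, h3⟩ ↦ ⟨h1, h3⟩
      · simp [hiX, hi]
      · simp
    · exact le_bot_iff.1 (hBX i hiX ▸ hB.iterate_le _ i)
  · refine le_bot_iff.1 ((hB.iterate_le _ i).trans ?_)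
    rcases hi.eq_or_lt with rfl | hi
    · exact hB.zero_eq.le
    · exact (hpos i hi).le

end Order

end LieGrading

/-! ### From solvability to nilpotency. -/

namespace LieGrading

open LieModule LieAlgebra

variable {R L ι : Type*} [CommRing R] [LieRing L] [LieAlgebra R L]

theorem lie_mem_lowerCentralSeries {d e : ℕ} {x y : L} (hx : x ∈ lowerCentralSeries R L L d)
    (hy : y ∈ lowerCentralSeries R L L e) : ⁅x, y⁆ ∈ lowerCentralSeries R L L (d + e + 1) := by
  induction e generalizing d x y with
  | zero =>
    rw [← lie_skew, lowerCentralSeries_succ]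
    exact neg_mem (LieSubmodule.lie_mem_lie (LieSubmodule.mem_top y) hx)
  | succ e ih =>
    rw [lowerCentralSeries_succ, ← LieSubmodule.mem_toSubmodule,
      LieSubmodule.lieIdeal_oper_eq_linear_span'] at hy
    rw [← LieSubmodule.mem_toSubmodule]
    refine lie_mem_of_span_right (fun w hw ↦ ?_) hy
    obtain ⟨u, -, v, hv, rfl⟩ := hw
    have hxu : ⁅x, u⁆ ∈ lowerCentralSeries R L L (d + 1) := by
      rw [← lie_skew, lowerCentralSeries_succ]
      exact neg_mem (LieSubmodule.lie_mem_lie (LieSubmodule.mem_top u) hx)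
    rw [leibniz_lie x u v, LieSubmodule.mem_toSubmodule]
    refine add_mem ?_ ?_
    · have := ih hxu hv
      rwa [show d + 1 + e + 1 = d + (e + 1) + 1 by ring] at this
    · rw [lowerCentralSeries_succ]
      exact LieSubmodule.lie_mem_lie (LieSubmodule.mem_top u) (ih hx hv)

variable [AddCommGroup ι] {A : ι → Submodule R L}

theorem derivedSeries_le_iSup_inf (hA : IsGraded A) (hA' : ⨆ i, A i = ⊤) (k : ℕ) :
    (derivedSeries R L k).toSubmodule ≤ ⨆ i, (derivedSeries R L k).toSubmodule ⊓ A i :=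
  (derivedSeries_le_iSup hA' k).trans
    (iSup_mono fun i ↦ le_inf (iterate_le_derivedSeries k i) (hA.iterate_le k i))

variable [LinearOrder ι]

/-- Left-normed commutators `[v, y₁, …, y_r]` of weight `b` and total degree `s` with `v` in the
ideal `M` and `y_i` homogeneous of positive weight; here an element of
`lowerCentralSeries R L L d` has degree `d + 1`. -/
inductive IsUp (A : ι → Submodule R L) (M : LieIdeal R L) : ℕ → ι → L → Prop
  | of {b v} : v ∈ M → v ∈ A b → IsUp A M 0 b v
  | lie {s d t b l k v y} : s + d + 1 = t → b + l = k → 0 < l → IsUp A M s b v →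
      y ∈ lowerCentralSeries R L L d → y ∈ A l → IsUp A M t k ⁅v, y⁆

/-- Left-normed commutators as in `IsUp` followed by homogeneous entries of negative weight. -/
inductive IsUpDown (A : ι → Submodule R L) (M : LieIdeal R L) : ℕ → ι → L → Prop
  | of {s b v} : IsUp A M s b v → IsUpDown A M s b v
  | lie {s d t b l k v y} : s + d + 1 = t → b + l = k → l < 0 → IsUpDown A M s b v →
      y ∈ lowerCentralSeries R L L d → y ∈ A l → IsUpDown A M t k ⁅v, y⁆

/-- The span of the commutators of total degree `s` described by `IsUpDown`. -/
def upDown (A : ι → Submodule R L) (M : LieIdeal R L) (s : ℕ) : Submodule R L :=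
  Submodule.span R {v | ∃ b, IsUpDown A M s b v}

variable {M : LieIdeal R L}

theorem lie_mem_upDown_of_neg {s d t : ℕ} {l : ι} {v y : L} (ht : s + d + 1 = t) (hl : l < 0)
    (hv : v ∈ upDown A M s) (hy : y ∈ lowerCentralSeries R L L d) (hyl : y ∈ A l) :
    ⁅v, y⁆ ∈ upDown A M t := by
  refine lie_mem_of_span_left (fun w hw ↦ ?_) hv
  obtain ⟨b, hw⟩ := hw
  exact Submodule.subset_span ⟨b + l, .lie ht rfl hl hw hy hyl⟩

/-- A new positive entry is moved left past the negative ones. Each swap creates a merged entry `⁅z,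
y⁆` whose degree is the sum of the two, so the total degree is preserved. -/
theorem lie_mem_upDown (hA : IsGraded A) {s d t : ℕ} {l : ι} {v y : L} (ht : s + d + 1 = t)
    (hv : v ∈ upDown A M s) (hy : y ∈ lowerCentralSeries R L L d) (hyl : y ∈ A l) :
    ⁅v, y⁆ ∈ upDown A M t := by
  rcases lt_trichotomy l 0 with hl | hl | hl
  · exact lie_mem_upDown_of_neg ht hl hv hy hyl
  · rw [hA.eq_zero hl hyl, lie_zero]; exact Submodule.zero_mem _
  refine lie_mem_of_span_left (fun w hw ↦ ?_) hv
  obtain ⟨b, hw⟩ := hw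
  clear hv v
  induction hw generalizing l d t y with
  | of hw => exact Submodule.subset_span ⟨_, .of (.lie ht rfl hl hw hy hyl)⟩
  | @lie s e s' b m k v z hs' hk hm hv hz hzm ih =>
    have hcalc : ⁅⁅v, z⁆, y⁆ = ⁅⁅v, y⁆, z⁆ + ⁅v, ⁅z, y⁆⁆ := by
      rw [leibniz_lie v z y, ← lie_skew ⁅v, y⁆ z]; abel
    rw [hcalc]
    refine Submodule.add_mem _ (lie_mem_upDown_of_neg (s := s + d + 1) (d := e) (by omega) hm
      (ih rfl hy hyl hl) hz hzm) ?_
    have hzy := hA.lie_mem hzm hyl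
    have hzy' := lie_mem_lowerCentralSeries hz hy
    rcases lt_trichotomy (m + l) 0 with h | h | h
    · exact lie_mem_upDown_of_neg (s := s) (by omega) h (Submodule.subset_span ⟨b, hv⟩) hzy' hzy
    · rw [hA.eq_zero h hzy, lie_zero]; exact Submodule.zero_mem _
    · exact ih (by omega) hzy' hzy h

theorem lowerCentralSeries_le_upDown (hA : IsGraded A) (hA' : ⨆ i, A i = ⊤)
    (hM : M.toSubmodule ≤ ⨆ i, M.toSubmodule ⊓ A i) {c : ℕ} (hc : lowerCentralSeries R L L c ≤ M)
    (t : ℕ) : (lowerCentralSeries R L L (c + t)).toSubmodule ≤ upDown A M t := by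
  induction t with
  | zero =>
    refine (show (lowerCentralSeries R L L c).toSubmodule ≤ M.toSubmodule from hc).trans
      (hM.trans (iSup_le fun i v hv ↦ ?_))
    exact Submodule.subset_span ⟨i, .of (.of hv.1 hv.2)⟩
  | succ t ih =>
    rw [← add_assoc, lowerCentralSeries_succ, LieSubmodule.lieIdeal_oper_eq_linear_span',
      Submodule.span_le]
    rintro _ ⟨x, -, v, hv, rfl⟩
    have hx : x ∈ ⨆ i, A i := hA' ▸ Submodule.mem_top
    rw [Submodule.iSup_eq_span] at hx
    rw [← lie_skew]
    refine Submodule.neg_mem _ (lie_mem_of_span_right (fun y hy ↦ ?_) hx)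
    obtain ⟨i, hy⟩ := Set.mem_iUnion.1 hy
    exact lie_mem_upDown hA (d := 0) rfl (ih hv) (by simp) hy

theorem IsUp.mem (hA : IsGraded A) {s : ℕ} {b : ι} {v : L} (h : IsUp A M s b v) :
    v ∈ M ∧ v ∈ A b := by
  induction h with
  | of h1 h2 => exact ⟨h1, h2⟩
  | lie _ hk _ _ _ hy ih =>
    exact ⟨lie_mem_left _ _ _ _ _ ih.1, hA.lie_mem' hk ih.2 hy⟩

theorem IsUpDown.mem (hA : IsGraded A) {s : ℕ} {b : ι} {v : L} (h : IsUpDown A M s b v) :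
    v ∈ M ∧ v ∈ A b := by
  induction h with
  | of h => exact h.mem hA
  | lie _ hk _ _ _ hy ih =>
    exact ⟨lie_mem_left _ _ _ _ _ ih.1, hA.lie_mem' hk ih.2 hy⟩

variable [IsOrderedAddMonoid ι] {X : Finset ι} {M' : LieIdeal R L} {c : ℕ}

/-- An entry with `c ≤ d` lies in `M`, so the bracket falls into `⁅M, M⁆`; any other adds at most
`c` to the degree, paid for by the growth of the counter from `n` to `n'`. -/
theorem lie_mem_or_le {d n n' s B : ℕ} {v y : L} (hM' : ⁅M, M⁆ ≤ M')
    (hc : lowerCentralSeries R L L c ≤ M) (hv : v ∈ M) (hy : y ∈ lowerCentralSeries R L L d)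
    (hn : v ∉ M' → n < n') (h : v ∈ M' ∨ s ≤ B + c * n) :
    ⁅v, y⁆ ∈ M' ∨ s + d + 1 ≤ B + c * n' := by
  by_cases hvM' : v ∈ M'
  · exact .inl (lie_mem_left _ _ _ _ _ hvM')
  rcases le_or_gt c d with hd | hd
  · refine .inl (hM' (LieSubmodule.lie_mem_lie hv (hc ?_)))
    exact antitone_lowerCentralSeries R L L hd hy
  · right
    have h1 := h.resolve_left hvM'
    have h2 : c * (n + 1) ≤ c * n' := Nat.mul_le_mul_left c (hn hvM')
    rw [mul_add] at h2
    omega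

theorem IsUp.mem_or_le (hA : IsGraded A) (hX : ∀ i ∉ X, A i = ⊥) (hM' : ⁅M, M⁆ ≤ M')
    (hc : lowerCentralSeries R L L c ≤ M) {s : ℕ} {b : ι} {v : L} (h : IsUp A M s b v) :
    v ∈ M' ∨ s ≤ 0 + c * (X.filter (· < b)).card := by
  induction h with
  | of => simp
  | @lie s d t b l k v y ht hk hl hv hy hyl ih =>
    subst ht
    refine lie_mem_or_le hM' hc (hv.mem hA).1 hy (fun hvM' ↦ ?_) ih
    have hbk : b < k := by rw [← hk]; exact lt_add_of_pos_right b hl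
    have hb : b ∈ X := by
      by_contra hb
      have := (hv.mem hA).2
      rw [hX b hb, Submodule.mem_bot] at this
      exact hvM' (this ▸ M'.zero_mem)
    refine Finset.card_lt_card (Finset.ssubset_iff_of_subset ?_ |>.2 ⟨b, ?_, ?_⟩)
    · intro m
      simp only [Finset.mem_filter]
      exact fun ⟨h1, h2⟩ ↦ ⟨h1, h2.trans hbk⟩
    · simp [hb, hbk]
    · simp

theorem IsUpDown.mem_or_le (hA : IsGraded A) (hX : ∀ i ∉ X, A i = ⊥) (hM' : ⁅M, M⁆ ≤ M')
    (hc : lowerCentralSeries R L L c ≤ M) {s : ℕ} {b : ι} {v : L} (h : IsUpDown A M s b v) :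
    v ∈ M' ∨ s ≤ c * (X.card - 1) + c * (X.filter (b < ·)).card := by
  induction h with
  -- The climb ends at a weight of `X`, hence has at most `X.card - 1` steps; this gives the fixed
  -- term of the bound.
  | @of s b v h =>
    by_cases hb : b ∈ X
    · refine (h.mem_or_le hA hX hM' hc).imp_right fun hs ↦ ?_
      have hlt : (X.filter (· < b)).card < X.card :=
        Finset.card_lt_card (Finset.filter_ssubset.2 ⟨b, hb, lt_irrefl b⟩)
      have := Nat.mul_le_mul_left c (Nat.le_sub_one_of_lt hlt)
      omega
    · have := (h.mem hA).2
      rw [hX b hb, Submodule.mem_bot] at this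
      exact .inl (this ▸ M'.zero_mem)
  | @lie s d t b l k v y ht hk hl hv hy hyl ih =>
    subst ht
    refine lie_mem_or_le hM' hc (hv.mem hA).1 hy (fun hvM' ↦ ?_) ih
    have hbk : k < b := by rw [← hk]; exact add_lt_of_neg_right b hl
    have hb : b ∈ X := by
      by_contra hb
      have := (hv.mem hA).2
      rw [hX b hb, Submodule.mem_bot] at this
      exact hvM' (this ▸ M'.zero_mem)
    refine Finset.card_lt_card (Finset.ssubset_iff_of_subset ?_ |>.2 ⟨b, ?_, ?_⟩)
    · intro m
      simp only [Finset.mem_filter]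
      exact fun ⟨h1, h2⟩ ↦ ⟨h1, hbk.trans h2⟩
    · simp [hb, hbk]
    · simp

theorem upDown_le (hA : IsGraded A) (hX : ∀ i ∉ X, A i = ⊥) (hM' : ⁅M, M⁆ ≤ M')
    (hc : lowerCentralSeries R L L c ≤ M) {s : ℕ} (hs : 2 * (c * (X.card - 1)) < s) :
    upDown A M s ≤ M'.toSubmodule := by
  refine Submodule.span_le.2 ?_
  rintro v ⟨b, hv⟩
  by_cases hb : b ∈ X
  · refine (hv.mem_or_le hA hX hM' hc).resolve_right fun h ↦ ?_
    have hlt : (X.filter (b < ·)).card < X.card :=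
      Finset.card_lt_card (Finset.filter_ssubset.2 ⟨b, hb, lt_irrefl b⟩)
    have := Nat.mul_le_mul_left c (Nat.le_sub_one_of_lt hlt)
    omega
  · have := (hv.mem hA).2
    rw [hX b hb, Submodule.mem_bot] at this
    exact this ▸ M'.zero_mem

/-- One more derived step costs `2 * c * (X.card - 1) + 1` further terms, one more than a climb and
a descent can absorb. -/
theorem lowerCentralSeries_le_derivedSeries (hA : IsGraded A) (hA' : ⨆ i, A i = ⊤)
    (hX : ∀ i ∉ X, A i = ⊥) (hX' : X.Nonempty) (k : ℕ) :
    lowerCentralSeries R L L ((2 * X.card) ^ k) ≤ derivedSeries R L (k + 1) := by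
  induction k with
  | zero =>
    rw [pow_zero, derivedSeries_def, derivedSeriesOfIdeal_succ R L (k := 0)]
    exact (lowerCentralSeries_succ R L L 0).le
  | succ k ih =>
    set c := (2 * X.card) ^ k with hc
    have hX0 : 0 < X.card := hX'.card_pos
    have hc0 : 0 < c := by positivity
    have hpow : c + (2 * (c * (X.card - 1)) + 1) ≤ (2 * X.card) ^ (k + 1) := by
      obtain ⟨m, hm⟩ : ∃ m, X.card = m + 1 := ⟨X.card - 1, by omega⟩
      rw [pow_succ, ← hc, hm, Nat.add_sub_cancel]
      nlinarith
    refine (antitone_lowerCentralSeries R L L hpow).trans ?_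
    have h1 := lowerCentralSeries_le_upDown hA hA' (derivedSeries_le_iSup_inf hA hA' (k + 1)) ih
      (2 * (c * (X.card - 1)) + 1)
    refine h1.trans (upDown_le hA hX ?_ ih (Nat.lt_succ_self _))
    rw [derivedSeries_def, derivedSeries_def, derivedSeriesOfIdeal_succ R L (k := k + 1)]

theorem derivedSeries_eq_bot (hA : IsGraded A) (hA' : ⨆ i, A i = ⊤)
    (hX : ∀ i ∉ X, A i = ⊥) :
    derivedSeries R L ((X.filter (· < 0)).card + (2 ^ (X.filter (0 < ·)).card - 1)) = ⊥ := by
  rw [← LieSubmodule.toSubmodule_eq_bot, ← le_bot_iff]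
  refine (derivedSeries_le_iSup hA' _).trans (iSup_le fun i ↦ ?_)
  rw [iterate_derived_eq_bot hA hX i]

theorem derivedSeries_two_pow_eq_bot (hA : IsGraded A) (hA' : ⨆ i, A i = ⊤)
    (hX : ∀ i ∉ X, A i = ⊥) : derivedSeries R L (2 ^ (X.card - 1)) = ⊥ := by
  have hle : ∀ n : ℕ, n ≤ 2 ^ (n - 1) := fun n ↦ by
    have := (n - 1).lt_two_pow_self
    omega
  suffices ∃ n ≤ 2 ^ (X.card - 1), derivedSeries R L n = ⊥ by
    obtain ⟨n, hn, h⟩ := this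
    exact le_bot_iff.1 (h ▸ derivedSeriesOfIdeal_antitone ⊤ hn)
  have hcard : (X.filter (· < 0)).card + (X.filter (0 < ·)).card ≤ X.card := by
    rw [← Finset.card_union_of_disjoint]
    · exact Finset.card_le_card
        (Finset.union_subset (Finset.filter_subset _ _) (Finset.filter_subset _ _))
    · exact Finset.disjoint_filter.2 fun _ _ h ↦ h.not_gt
  -- With no negative weights the general bound would be too large, so the grading is reflected and
  -- only the cheap negative case remains.
  rcases Nat.eq_zero_or_pos (X.filter (· < 0)).card with h0 | h0
  · let A' : ι → Submodule R L := fun i ↦ A (-i)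
    have hgr : IsGraded A' :=
      ⟨fun {i j _ _} hx hy ↦ hA.lie_mem' (neg_add i j).symm hx hy, by simp [A', hA.zero_eq]⟩
    have htop : ⨆ i, A' i = ⊤ := (Equiv.neg ι).iSup_comp (g := A) |>.trans hA'
    have hsupp : ∀ i ∉ X.map (Equiv.neg ι).toEmbedding, A' i = ⊥ := fun i hi ↦
      hX _ fun h ↦ hi (Finset.mem_map.2 ⟨-i, h, by simp⟩)
    have h := derivedSeries_eq_bot hgr htop hsupp
    have hpos : ((X.map (Equiv.neg ι).toEmbedding).filter (0 < ·)).card = 0 := by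
      rw [Finset.filter_map, Finset.card_map, ← h0]
      congr 1
      ext i
      simp
    rw [hpos] at h
    refine ⟨_, ?_, h⟩
    refine le_trans ?_ (hle X.card)
    have := Finset.card_filter_le (X.map (Equiv.neg ι).toEmbedding) (· < 0)
    rw [Finset.card_map] at this
    simpa using this
  · refine ⟨_, ?_, derivedSeries_eq_bot hA hA' hX⟩
    set q := (X.filter (· < 0)).card
    set p := (X.filter (0 < ·)).card
    have h1 : 2 ^ (q + p - 1) ≤ 2 ^ (X.card - 1) := Nat.pow_le_pow_right (by norm_num) (by omega)
    have h2 : 2 ^ (q + p - 1) = 2 ^ (q - 1) * 2 ^ p := by rw [← pow_add]; congr 1; omega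
    have h3 := hle q
    have h4 : 0 < 2 ^ p := by positivity
    have h5 : 0 < 2 ^ (q - 1) := by positivity
    have h6 : q + (2 ^ p - 1) ≤ 2 ^ (q - 1) * 2 ^ p := by
      obtain ⟨u, hu⟩ : ∃ u, 2 ^ p = u + 1 := ⟨2 ^ p - 1, by omega⟩
      rw [hu, Nat.add_sub_cancel]
      nlinarith
    omega

/-- A Lie algebra graded by an ordered group with trivial zero component and finite support `X` is
nilpotent of class at most `|X| ^ 2 ^ |X|`. -/
theorem lowerCentralSeries_eq_bot (hA : IsGraded A) (hA' : ⨆ i, A i = ⊤)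
    (hX : ∀ i ∉ X, A i = ⊥) : lowerCentralSeries R L L (X.card ^ 2 ^ X.card) = ⊥ := by
  rcases X.eq_empty_or_nonempty with rfl | hne
  · have : (⊤ : Submodule R L) = ⊥ := by
      rw [← hA', iSup_eq_bot]
      exact fun i ↦ hX i (Finset.notMem_empty i)
    rw [← LieSubmodule.toSubmodule_eq_bot, ← le_bot_iff, ← this]
    exact le_top
  have hN : 0 < X.card := hne.card_pos
  obtain ⟨d, hd⟩ : ∃ d, 2 ^ (X.card - 1) = d + 1 :=
    ⟨2 ^ (X.card - 1) - 1, by have := Nat.two_pow_pos (X.card - 1); omega⟩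
  have h := lowerCentralSeries_le_derivedSeries hA hA' hX hne d
  rw [← hd, derivedSeries_two_pow_eq_bot hA hA' hX, le_bot_iff] at h
  refine le_bot_iff.1 (h ▸ antitone_lowerCentralSeries R L L ?_)
  have hexp : 2 ^ X.card = 2 * (d + 1) := by
    rw [← hd, ← pow_succ']; congr 1; omega
  -- The estimate `2 * X.card ≤ X.card ^ 2` needs at least two weights; for one weight `d = 0`.
  rcases (show 1 ≤ X.card from hN).eq_or_lt with h1 | h1
  · rw [← h1] at hd ⊢
    have : d = 0 := by simpa using hd.symm
    simp [this]
  · calc (2 * X.card) ^ d ≤ (X.card ^ 2) ^ d := Nat.pow_le_pow_left (by nlinarith) d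
      _ = X.card ^ (2 * d) := (pow_mul _ _ _).symm
      _ ≤ X.card ^ 2 ^ X.card := Nat.pow_le_pow_right hN (by omega)

end LieGrading

/-! ### Weight decompositions as gradings. -/

namespace LieModule

section Derivation

variable {F H M : Type*} [Field F] [LieRing H] [LieAlgebra F H] [LieRing.IsNilpotent H]
  [AddCommGroup M] [Module F M] [LieRingModule H M] [LieModule F H M]

/-- If a Lie algebra acts by derivations of a bilinear product, then the product of two weight
spaces lies in the weight space of the sum. -/
theorem apply_mem_genWeightSpace_add (B : M →ₗ[F] M →ₗ[F] M)
    (hB : ∀ (x : H) (m m' : M), ⁅x, B m m'⁆ = B ⁅x, m⁆ m' + B m ⁅x, m'⁆) {χ₁ χ₂ : H → F} {m m' : M}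
    (hm : m ∈ genWeightSpace M χ₁) (hm' : m' ∈ genWeightSpace M χ₂) :
    B m m' ∈ genWeightSpace M (χ₁ + χ₂) := by
  -- The derivation rule says exactly that the product is an equivariant map on `M ⊗ M`.
  let g : M ⊗[F] M →ₗ⁅F, H⁆ M :=
    { TensorProduct.lift B with
      map_lie' := fun {x t} ↦ by
        induction t using TensorProduct.induction_on with
        | zero => simp
        | tmul a b => simp [TensorProduct.LieModule.lie_tmul_right, hB]
        | add a b ha hb => simpa [lie_add, map_add] using congrArg₂ (· + ·) ha hb }
  rw [mem_genWeightSpace] at hm hm' ⊢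
  intro x
  have h := LieModule.weight_vector_multiplication M M M g (χ₁ x) (χ₂ x) x
  have h1 : m ∈ (toEnd F H M x).maxGenEigenspace (χ₁ x) :=
    Module.End.mem_maxGenEigenspace _ _ _ |>.2 (hm x)
  have h2 : m' ∈ (toEnd F H M x).maxGenEigenspace (χ₂ x) :=
    Module.End.mem_maxGenEigenspace _ _ _ |>.2 (hm' x)
  exact Module.End.mem_maxGenEigenspace _ _ _ |>.1 (h ⟨⟨m, h1⟩ ⊗ₜ ⟨m', h2⟩, rfl⟩)

/-- The zero weight space is a nilpotent module, and a nonzero nilpotent module has a nonzero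
invariant. -/
theorem genWeightSpace_zero_eq_bot [IsNoetherian F M]
    (h : maxTrivSubmodule F H M = ⊥) : genWeightSpace M (0 : H → F) = ⊥ := by
  by_contra hne
  have : Nontrivial (genWeightSpace M (0 : H → F)) :=
    (LieSubmodule.nontrivial_iff_ne_bot F H M).2 hne
  have : Nontrivial (maxTrivSubmodule F H (genWeightSpace M (0 : H → F))) :=
    nontrivial_max_triv_of_isNilpotent F H _
  obtain ⟨⟨v, hv⟩, hv0⟩ := exists_ne (0 : maxTrivSubmodule F H (genWeightSpace M (0 : H → F)))
  have : (v : M) ∈ maxTrivSubmodule F H M :=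
    (mem_maxTrivSubmodule F H M _).2 fun x ↦ by
      rw [← LieSubmodule.coe_bracket, (mem_maxTrivSubmodule F H _ v).1 hv x, ZeroMemClass.coe_zero]
  rw [h, LieSubmodule.mem_bot] at this
  exact hv0 (Subtype.ext (Subtype.ext this))

/-- A finite-dimensional Lie algebra on which a nilpotent Lie algebra acts by derivations without
invariants is nilpotent, of class bounded in terms of the number of weights. -/
theorem lowerCentralSeries_eq_bot_of_derivation [CharZero F] [IsAlgClosed F]
    [FiniteDimensional F M] {N : Type*} [LieRing N] [LieAlgebra F N] (e : M ≃ₗ[F] N)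
    (he : ∀ (x : H) (m m' : M),
      ⁅x, e.symm ⁅e m, e m'⁆⁆ = e.symm ⁅e ⁅x, m⁆, e m'⁆ + e.symm ⁅e m, e ⁅x, m'⁆⁆)
    (h : maxTrivSubmodule F H M = ⊥) :
    lowerCentralSeries F N N (Nat.card (Weight F H M) ^ 2 ^ Nat.card (Weight F H M)) = ⊥ := by
  classical
  let B : M →ₗ[F] M →ₗ[F] M := LinearMap.mk₂ F (fun m m' ↦ e.symm ⁅e m, e m'⁆)
    (by simp) (by simp) (by simp) (by simp)
  have hB {χ₁ χ₂ : H → F} {m m' : M} : m ∈ genWeightSpace M χ₁ → m' ∈ genWeightSpace M χ₂ →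
      e.symm ⁅e m, e m'⁆ ∈ genWeightSpace M (χ₁ + χ₂) := apply_mem_genWeightSpace_add B he
  have h0 := genWeightSpace_zero_eq_bot h
  -- Finitely many nonzero vectors of a `ℚ`-space avoid the kernel of some functional. It may
  -- identify weights, so only `X.card ≤ Nat.card (Weight F H M)` holds.
  obtain ⟨φ, hφ⟩ := Module.exists_dual_forall_apply_ne_zero (K := ℚ)
    (fun χ : Weight F H M ↦ (χ : H → F))
    fun χ hχ ↦ χ.genWeightSpace_ne_bot' (by rw [← h0, ← hχ]; rfl)
  let W (q : ℚ) : Set M := {m | ∃ χ : Weight F H M, φ χ = q ∧ m ∈ genWeightSpace M χ}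
  let A (q : ℚ) : Submodule F N := Submodule.span F (e '' W q)
  let X : Finset ℚ := Finset.univ.image fun χ : Weight F H M ↦ φ χ
  have hX : ∀ q ∉ X, A q = ⊥ := by
    intro q hq
    rw [Submodule.span_eq_bot]
    rintro _ ⟨m, ⟨χ, hχ, _⟩, rfl⟩
    exact absurd (Finset.mem_image.2 ⟨χ, Finset.mem_univ _, hχ⟩) hq
  have hA : LieGrading.IsGraded A := by
    refine ⟨fun {p q x y} hx hy ↦ LieGrading.lie_mem_of_span ?_ hx hy, hX 0 ?_⟩
    · rintro _ ⟨m, ⟨χ₁, h1, hm⟩, rfl⟩ _ ⟨m', ⟨χ₂, h2, hm'⟩, rfl⟩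
      have hmm := hB hm hm'
      by_cases hbot : genWeightSpace M (χ₁ + χ₂ : H → F) = ⊥
      · rw [hbot, LieSubmodule.mem_bot, LinearEquiv.map_eq_zero_iff] at hmm
        rw [hmm]
        exact Submodule.zero_mem _
      · exact Submodule.subset_span ⟨_, ⟨⟨χ₁ + χ₂, hbot⟩, by simp [← h1, ← h2], hmm⟩, by simp⟩
    · intro h
      obtain ⟨χ, _, hχ⟩ := Finset.mem_image.1 h
      exact hφ χ hχ
  have htop : ⨆ q, A q = ⊤ := by
    have h := iSup_genWeightSpace_eq_top' F H M
    rw [← LieSubmodule.toSubmodule_inj, LieSubmodule.iSup_toSubmodule,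
      LieSubmodule.top_toSubmodule] at h
    rw [← top_le_iff, ← Submodule.map_top (e : M →ₗ[F] N) |>.trans e.range, ← h,
      Submodule.map_iSup]
    refine iSup_le fun χ ↦ le_iSup_of_le (φ χ) ?_
    rintro _ ⟨m, hm, rfl⟩
    exact Submodule.subset_span ⟨m, ⟨χ, rfl, hm⟩, rfl⟩
  have hcard : X.card ≤ Nat.card (Weight F H M) := by
    rw [Nat.card_eq_fintype_card]
    exact Finset.card_image_le
  refine le_bot_iff.1 (LieGrading.lowerCentralSeries_eq_bot hA htop hX ▸
    antitone_lowerCentralSeries F N N ?_)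
  rcases Nat.eq_zero_or_pos (Nat.card (Weight F H M)) with h0 | h0
  · rw [h0] at hcard ⊢
    rw [Nat.le_zero.1 hcard]
  · exact (Nat.pow_le_pow_left hcard _).trans
      (Nat.pow_le_pow_right h0 (Nat.pow_le_pow_right two_pos hcard))

end Derivation

/-! ### Extension of scalars from `K` to `F`. -/

section BaseChange

variable {K L M : Type*} (F : Type*) [Field K] [Field F] [Algebra K F] [LieRing L]
  [LieAlgebra K L] [AddCommGroup M] [Module K M] [LieRingModule L M] [LieModule K L M]

/-- The coordinates of an invariant with respect to a `K`-basis of `F` are invariants in `M`. -/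
theorem maxTrivSubmodule_baseChange_eq_bot (h : maxTrivSubmodule K L M = ⊥) :
    maxTrivSubmodule F (F ⊗[K] L) (F ⊗[K] M) = ⊥ := by
  rw [LieSubmodule.eq_bot_iff]
  intro w hw
  let b := Module.Free.chooseBasis K F
  let r := TensorProduct.equivFinsuppOfBasisLeft b (N := M)
  have hr (x : L) (w : F ⊗[K] M) (i) : r ⁅(1 : F) ⊗ₜ[K] x, w⁆ i = ⁅x, r w i⁆ := by
    induction w using TensorProduct.induction_on with
    | zero => simp
    | tmul a m => simp [r]
    | add a b ha hb => simp [ha, hb]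
  refine r.map_eq_zero_iff.1 (Finsupp.ext fun i ↦ ?_)
  have : r w i ∈ maxTrivSubmodule K L M := (mem_maxTrivSubmodule K L M _).2 fun x ↦ by
    rw [← hr, (mem_maxTrivSubmodule F _ _ w).1 hw]
    simp
  rwa [h, LieSubmodule.mem_bot] at this

theorem lowerCentralSeries_eq_bot_of_baseChange {k : ℕ}
    (h : lowerCentralSeries F (F ⊗[K] L) (F ⊗[K] M) k = ⊥) : lowerCentralSeries K L M k = ⊥ := by
  rw [LieSubmodule.lowerCentralSeries_tensor_eq_baseChange] at h
  rw [LieSubmodule.eq_bot_iff]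
  intro m hm
  have := LieSubmodule.tmul_mem_baseChange_of_mem (1 : F) hm
  rw [h, LieSubmodule.mem_bot] at this
  exact Module.FaithfullyFlat.tensorProduct_mk_injective (A := K) (B := F) M
    (this.trans (TensorProduct.tmul_zero M 1).symm)

theorem lie_baseChange_symm_lie {N : Type*} [LieRing N] [LieAlgebra K N] (e : M ≃ₗ[K] N)
    (he : ∀ (x : L) (m m' : M),
      ⁅x, e.symm ⁅e m, e m'⁆⁆ = e.symm ⁅e ⁅x, m⁆, e m'⁆ + e.symm ⁅e m, e ⁅x, m'⁆⁆)
    (x : F ⊗[K] L) (m m' : F ⊗[K] M) :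
    ⁅x, (e.baseChange K F M N).symm ⁅e.baseChange K F M N m, e.baseChange K F M N m'⁆⁆ =
      (e.baseChange K F M N).symm ⁅e.baseChange K F M N ⁅x, m⁆, e.baseChange K F M N m'⁆ +
      (e.baseChange K F M N).symm ⁅e.baseChange K F M N m, e.baseChange K F M N ⁅x, m'⁆⁆ := by
  have h (t : F) (v : M) : e.baseChange K F M N (t ⊗ₜ v) = t ⊗ₜ e v := rfl
  have h' (t : F) (v : N) : (e.baseChange K F M N).symm (t ⊗ₜ v) = t ⊗ₜ e.symm v := rfl
  have hz (v : F ⊗[K] M) : ⁅(0 : F ⊗[K] L), v⁆ = 0 := zero_lie v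
  have hadd (x y : F ⊗[K] L) (v : F ⊗[K] M) : ⁅x + y, v⁆ = ⁅x, v⁆ + ⁅y, v⁆ := add_lie x y v
  generalize e.baseChange K F M N = E at h h' ⊢
  induction x using TensorProduct.induction_on with
  | zero => simp only [hz, map_zero, zero_lie, lie_zero, add_zero]
  | add x y hx hy => simp only [hadd, hx, hy, map_add, add_lie, lie_add]; abel
  | tmul a x =>
    induction m using TensorProduct.induction_on with
    | zero => simp
    | add x y hx hy => simp only [add_lie, hx, hy, map_add, lie_add]; abel
    | tmul b m =>
      induction m' using TensorProduct.induction_on with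
      | zero => simp
      | add x y hx hy => simp only [hx, hy, map_add, lie_add]; abel
      | tmul c m' =>
        simp only [h, h', LieAlgebra.ExtendScalars.bracket_tmul, he, TensorProduct.tmul_add,
          mul_assoc, mul_left_comm b a c]

end BaseChange

end LieModule

/-! ### Application to post-Lie structures. -/

namespace PostLieStructure

variable {K V : Type*} [Field K] [AddCommGroup V] [Module K V] {g n : LieBracket K V}

/-- The identity of `V`, as a map from the `g`-module to the Lie algebra `n`. -/
def modEquiv (A : PostLieStructure g n) : A.Mod ≃ₗ[K] n.Alg := LinearEquiv.refl K V

theorem lie_modEquiv_symm_lie (A : PostLieStructure g n) (x : g.Alg) (m m' : A.Mod) :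
    ⁅x, A.modEquiv.symm ⁅A.modEquiv m, A.modEquiv m'⁆⁆ =
      A.modEquiv.symm ⁅A.modEquiv ⁅x, m⁆, A.modEquiv m'⁆ +
        A.modEquiv.symm ⁅A.modEquiv m, A.modEquiv ⁅x, m'⁆⁆ :=
  A.mul_br x m m'

end PostLieStructure

theorem theorem3p3 {K V F : Type*} [Field K] [CharZero K]
    [AddCommGroup V] [Module K V] [FiniteDimensional K V]
    [Field F] [Algebra K F] [IsAlgClosed F]
    (g n : LieBracket K V) (A : PostLieStructure g n)
    [LieRing.IsNilpotent g.Alg] (hH0 : A.H0 = ⊥) :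
    Finite (A.Weights F) ∧
      LieRing.IsNilpotent n.Alg ∧
      LieModule.lowerCentralSeries K n.Alg n.Alg
        (Nat.card (A.Weights F) ^ 2 ^ Nat.card (A.Weights F)) = ⊥ := by
  have : CharZero F := charZero_of_injective_algebraMap (algebraMap K F).injective
  have : FiniteDimensional K A.Mod := inferInstanceAs (FiniteDimensional K V)
  have hT : LieModule.maxTrivSubmodule K g.Alg A.Mod = ⊥ :=
    (LieSubmodule.toSubmodule_eq_bot _).1 hH0
  have h := LieModule.lowerCentralSeries_eq_bot_of_baseChange F
    (LieModule.lowerCentralSeries_eq_bot_of_derivation (A.modEquiv.baseChange K F _ _)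
      (LieModule.lie_baseChange_symm_lie F A.modEquiv A.lie_modEquiv_symm_lie)
      (LieModule.maxTrivSubmodule_baseChange_eq_bot F hT))
  exact ⟨inferInstance, LieModule.IsNilpotent.mk (R := K) n.Alg h, h⟩
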